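/- Let $\mathrm{FI}$ be the category of finite sets and injections, and let an FI-module be a functor $W\colon \mathrm{FI}\to \mathbb{Z}\text{-Mod}$ (not necessarily finitely generated); write $W_T=W(T)$ and $W_n=W(\{1,\dots,n\})$. The degree $\deg W\in\{-\infty\}\cup\mathbb{N}\cup\{\infty\}$ of an FI-module is the infimum of all $k\in\{-\infty\}\cup\mathbb{N}\cup\{\infty\}$ such that $W_n=0$ for all $n\in\mathbb{N}$ with $n>k$. Let $H_0$ be the functor from FI-modules to FI-modules given by $$H_0(W)_T = W_T\,/\,\operatorname{span}\big(\operatorname{im}(f_*\colon W_S\to W_T)\ \big|\ f\colon S\hookrightarrow T,\ |S|<|T|\big),$$ and for $p\ge 0$ let $H_p$ be the $p$-th left derived functor of $H_0$. Let $W$ be an FI-module and let $k,d\in\{-\infty\}\cup\mathbb{N}$ be such that $\deg H_0(W)\le k$ and $\deg H_1(W)\le d$. Then $W$ has Castelnuovo--Mumford regularity at most $k+d-1$; that is, for every $p>0$, $$\deg H_p(W)\le p+k+d-1,$$ where the right-hand side is $-\infty$ if $k=-\infty$ or $d=-\infty$. -/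

import Mathlib

open CategoryTheory

/-- The objects of the category FI: finite sets. -/
structure FI : Type 1 where
  carrier : Type
  [finite : Finite carrier]

namespace FI

instance : CoeSort FI Type := ⟨FI.carrier⟩

instance (T : FI) : Finite T := T.finite

/-- The morphisms of FI are the injections. -/
instance : Category FI where
  Hom S T := S ↪ T
  id T := Function.Embedding.refl T
  comp f g := f.trans g

/-- The standard set with `n` elements. -/
def std (n : ℕ) : FI := ⟨Fin n⟩

theorem card_le_of_hom {S T : FI} (f : S ⟶ T) : Nat.card S ≤ Nat.card T :=
  Nat.card_le_card_of_injective (fun x : S => (show S ↪ T from f) x)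
    (show S ↪ T from f).injective

end FI

universe u

/-- FI-modules over a commutative ring `R`: functors from FI to `R`-modules. -/
abbrev FIModule (R : Type) [CommRing R] : Type (u + 1) := FI ⥤ ModuleCat.{u} R

namespace FIModule

section

variable {R : Type} [CommRing R]

/-- The degree of an FI-module, an element of `{-∞} ∪ ℕ ∪ {∞}`: the infimum of all `k` such that
`W_n = 0` for every natural number `n > k`. -/
noncomputable def deg (W : FIModule.{u} R) : WithBot ℕ∞ :=
  sInf {k : WithBot ℕ∞ | ∀ n : ℕ, k < (n : WithBot ℕ∞) → Subsingleton (W.obj (FI.std n))}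

/-- The span in `W_T` of the images of all `f_* : W_S → W_T` with `|S| < |T|`. -/
def lower (W : FIModule.{u} R) (T : FI) : Submodule R (W.obj T) :=
  Submodule.span R {x | ∃ (S : FI) (f : S ⟶ T) (y : W.obj S),
    Nat.card S < Nat.card T ∧ (W.map f).hom y = x}

theorem lower_le_comap_map (W : FIModule.{u} R) {T T' : FI} (g : T ⟶ T') :
    W.lower T ≤ (W.lower T').comap (W.map g).hom := by
  refine Submodule.span_le.2 ?_
  rintro _ ⟨S, f, y, h, rfl⟩
  exact Submodule.subset_span
    ⟨S, f ≫ g, y, h.trans_le (FI.card_le_of_hom g), by simp⟩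

theorem lower_le_comap_app {V W : FIModule.{u} R} (φ : V ⟶ W) (T : FI) :
    V.lower T ≤ (W.lower T).comap (φ.app T).hom := by
  refine Submodule.span_le.2 ?_
  rintro _ ⟨S, f, y, h, rfl⟩
  refine Submodule.subset_span ⟨S, f, (φ.app S).hom y, h, ?_⟩
  exact (NatTrans.naturality_apply φ f y).symm

/-- `H₀(W)_T` is the quotient of `W_T` by the span of the images of all `f_* : W_S → W_T`
with `|S| < |T|`. -/
def H0Obj (W : FIModule.{u} R) : FIModule.{u} R where
  obj T := ModuleCat.of R (W.obj T ⧸ W.lower T)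
  map {T T'} g := ModuleCat.ofHom
    (Submodule.mapQ (W.lower T) (W.lower T') (W.map g).hom (W.lower_le_comap_map g))
  map_id T := by
    apply ModuleCat.hom_ext
    refine Submodule.linearMap_qext _ (LinearMap.ext fun x => ?_)
    simp
  map_comp f g := by
    apply ModuleCat.hom_ext
    refine Submodule.linearMap_qext _ (LinearMap.ext fun x => ?_)
    simp

/-- The map `H₀(V) ⟶ H₀(W)` induced by a map `V ⟶ W` of FI-modules. -/
def H0Map {V W : FIModule.{u} R} (φ : V ⟶ W) : H0Obj V ⟶ H0Obj W where
  app T := ModuleCat.ofHom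
    (Submodule.mapQ (V.lower T) (W.lower T) (φ.app T).hom (lower_le_comap_app φ T))
  naturality {T T'} g := by
    apply ModuleCat.hom_ext
    refine Submodule.linearMap_qext _ (LinearMap.ext fun x => ?_)
    exact congrArg (Submodule.Quotient.mk (p := W.lower T')) (NatTrans.naturality_apply φ g x)

variable (R) in
/-- The functor `H₀` from FI-modules to FI-modules. -/
def H0 : FIModule.{u} R ⥤ FIModule.{u} R where
  obj := H0Obj
  map := H0Map
  map_id W := by
    ext T : 2
    apply ModuleCat.hom_ext
    exact Submodule.linearMap_qext _ (LinearMap.ext fun x => rfl)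
  map_comp φ ψ := by
    ext T : 2
    apply ModuleCat.hom_ext
    exact Submodule.linearMap_qext _ (LinearMap.ext fun x => rfl)

instance : (H0.{u} R).Additive where
  map_add {V W φ ψ} := by
    ext T : 2
    apply ModuleCat.hom_ext
    exact Submodule.linearMap_qext _ (LinearMap.ext fun x => rfl)

/-- An FI-module that is a direct sum of representable ones, with one summand
`R[Hom([n], -)]` for each `n` and each element of `W_n`. -/
noncomputable def freeCover (W : FIModule.{u} R) : FIModule.{u} R where
  obj T := ModuleCat.of R ((Σ n : ℕ, W.obj (FI.std n) × (FI.std n ⟶ T)) →₀ R)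
  map {T T'} g := ModuleCat.ofHom
    (Finsupp.lmapDomain R R (fun a => ⟨a.1, a.2.1, a.2.2 ≫ g⟩))
  map_id T := by
    ext a
    simp
  map_comp f g := by
    ext a
    simp

/-- The map out of `freeCover W` that sends the generator for `w ∈ W_n` to `v n w`. -/
noncomputable def freeCoverLift (W X : FIModule.{u} R)
    (v : ∀ n : ℕ, W.obj (FI.std n) → X.obj (FI.std n)) : freeCover W ⟶ X where
  app T := ModuleCat.ofHom
    (Finsupp.linearCombination R (fun a => (X.map a.2.2).hom (v a.1 a.2.1)))
  naturality {T T'} g := by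
    apply ModuleCat.hom_ext
    refine Finsupp.lhom_ext' fun a => LinearMap.ext_ring ?_
    simp [freeCover]

theorem freeCoverLift_single (W X : FIModule.{u} R)
    (v : ∀ n : ℕ, W.obj (FI.std n) → X.obj (FI.std n)) (T : FI) (n : ℕ)
    (a : W.obj (FI.std n) × (FI.std n ⟶ T)) :
    ((freeCoverLift W X v).app T).hom (Finsupp.single ⟨n, a⟩ 1) =
      (X.map a.2).hom (v n a.1) :=
  (Finsupp.linearCombination_single _ _ _).trans (one_smul R _)

theorem freeCover_hom_ext {W X : FIModule.{u} R} {φ ψ : freeCover W ⟶ X}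
    (h : ∀ (n : ℕ) (w : W.obj (FI.std n)),
      (φ.app (FI.std n)).hom (Finsupp.single ⟨n, w, 𝟙 _⟩ 1) =
        (ψ.app (FI.std n)).hom (Finsupp.single ⟨n, w, 𝟙 _⟩ 1)) : φ = ψ := by
  ext T : 2
  apply ModuleCat.hom_ext
  refine Finsupp.lhom_ext' fun a => LinearMap.ext_ring ?_
  obtain ⟨n, w, f⟩ := a
  have key : ∀ χ : freeCover W ⟶ X, (χ.app T).hom (Finsupp.single ⟨n, w, f⟩ 1) =
      (X.map f).hom ((χ.app (FI.std n)).hom (Finsupp.single ⟨n, w, 𝟙 _⟩ 1)) := by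
    intro χ
    have := NatTrans.naturality_apply χ f (Finsupp.single ⟨n, w, 𝟙 _⟩ 1)
    refine Eq.trans ?_ this
    refine congrArg (χ.app T).hom ?_
    exact ((Finsupp.mapDomain_single (f := fun a : (Σ m : ℕ, W.obj (FI.std m) ×
      (FI.std m ⟶ FI.std n)) => (⟨a.1, a.2.1, a.2.2 ≫ f⟩ :
        Σ m : ℕ, W.obj (FI.std m) × (FI.std m ⟶ T)))).trans (by simp)).symm
  exact (key φ).trans ((congrArg _ (h n w)).trans (key ψ).symm)

theorem app_surjective_of_epi {E X : FIModule.{u} R} (e : E ⟶ X) [Epi e] (T : FI) :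
    Function.Surjective (e.app T) :=
  (ModuleCat.epi_iff_surjective _).1 inferInstance

instance (W : FIModule.{u} R) : Projective (freeCover W) where
  factors {E X} f e he := by
    choose s hs using fun T => app_surjective_of_epi e T
    refine ⟨freeCoverLift W E fun n w =>
      s _ ((f.app (FI.std n)).hom (Finsupp.single ⟨n, w, 𝟙 _⟩ 1)), ?_⟩
    refine freeCover_hom_ext fun n w => ?_
    refine Eq.trans (congrArg (e.app (FI.std n)).hom ?_) (hs _ _)
    refine (freeCoverLift_single W E _ _ _ _).trans ?_
    simp

theorem exists_iso_std (T : FI) : ∃ n : ℕ, Nonempty (FI.std n ≅ T) := by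
  obtain ⟨n, ⟨e⟩⟩ := Finite.exists_equiv_fin T
  refine ⟨n, ⟨⟨e.symm.toEmbedding, e.toEmbedding, ?_, ?_⟩⟩⟩
  · exact Function.Embedding.ext fun x => e.apply_symm_apply x
  · exact Function.Embedding.ext fun x => e.symm_apply_apply x

/-- The category of FI-modules has enough projectives, so left derived functors exist. -/
instance : EnoughProjectives (FIModule.{u} R) where
  presentation W := ⟨{
    p := freeCover W
    f := freeCoverLift W W fun _ w => w
    epi := by
      have : ∀ T, Epi ((freeCoverLift W W fun _ w => w).app T) := by
        intro T
        rw [ModuleCat.epi_iff_surjective]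
        intro x
        obtain ⟨n, ⟨i⟩⟩ := exists_iso_std T
        refine ⟨Finsupp.single ⟨n, (W.map i.inv).hom x, i.hom⟩ 1, ?_⟩
        refine (freeCoverLift_single W W _ _ _ _).trans ?_
        exact ConcreteCategory.congr_hom (W.mapIso i).inv_hom_id x
      exact NatTrans.epi_of_epi_app _ }⟩

variable (R) in
/-- FI-homology: `H p` is the `p`-th left derived functor of `H0`. -/
noncomputable def H (p : ℕ) : FIModule.{u} R ⥤ FIModule.{u} R :=
  (H0.{u} R).leftDerived p

end

end FIModule

/-
Let `S` be the shift functor, and let `K` and `D` be the kernel and the cokernel of `V ⟶ SV`.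
For projective `P`, the sequences `0 ⟶ H₀(P)_T ⟶ H₀(SP)_T ⟶ H₀(P)_{T ⊔ {∗}} ⟶ 0` are exact, so
`H_{p+1}(V)_{n+1} = 0` if and only if `H_{p+1}(V)_n ⟶ H_{p+1}(SV)_n` is epi and
`H_p(V)_n ⟶ H_p(SV)_n` is mono. One consequence is that `H_p(V)_n = 0` as soon as `V_{n-p} = 0`.
Another is that if `H₀(V)` and `H₁(V)` have degree at most `k` and `d`, then `H₀(D)` and `H₁(D)`
have degree at most `k - 1` and `d - 1`, so the higher homology of `D` is bounded by induction on
`k` (on `n` when `H₁(V) = 0`). Proper inclusions act by zero on `K`, so `K = H₀(K)`, and `K_n = 0`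
whenever `H₁(V)_{n+1}` and `H₂(D)_n` vanish. The bounds on `K` and `D` give the one on `V`.
-/

section DerivedLongExactSequence

open Limits HomologicalComplex

universe v v' v'' w w' w''

variable {C : Type w} [Category.{v} C] [Abelian C] {D : Type w'} [Category.{v'} D] [Abelian D]

open homotopyCofiber in
/-- The cone of the identity of a complex is contractible. -/
noncomputable def coneIdContraction (K : ChainComplex C ℕ) :
    Homotopy (𝟙 (homotopyCofiber (𝟙 K))) 0 where
  hom i j := if hij : (ComplexShape.down ℕ).Rel j i then
    sndX (𝟙 K) i ≫ inlX (𝟙 K) i j hij else 0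
  zero i j hij := dif_neg hij
  comm n := by
    have rel (m : ℕ) : (ComplexShape.down ℕ).Rel (m + 1) m := rfl
    rw [prevD_eq _ (rel n)]
    rcases n with - | n
    · have h : 𝟙 (X (𝟙 K) 0) = sndX (𝟙 K) 0 ≫ inlX (𝟙 K) 0 1 (rel 0) ≫ d (𝟙 K) 1 0 :=
        ext_from_X' (𝟙 K) 0 (by simp) (by simp [inlX_d' (𝟙 K) 1 0 (rel 0)])
      simpa [dNext, -inrX_d] using! h
    · have h : 𝟙 (X (𝟙 K) (n + 1)) =
          d (𝟙 K) (n + 1) n ≫ sndX (𝟙 K) n ≫ inlX (𝟙 K) n (n + 1) (rel n) +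
          sndX (𝟙 K) (n + 1) ≫ inlX (𝟙 K) (n + 1) (n + 2) (rel _) ≫ d (𝟙 K) (n + 2) (n + 1) :=
        ext_from_X (𝟙 K) n (n + 1) (rel n) (by simp [d_sndX_assoc (𝟙 K) (n + 1) n (rel n)])
          (by simp [inlX_d (𝟙 K) (n + 2) (n + 1) n (rel _) (rel n)])
      simpa [dNext_eq _ (rel n)] using! h

lemma shortExact_map_mapHomologicalComplex {T : ShortComplex (ChainComplex C ℕ)}
    (hT : T.ShortExact) (hP : ∀ n, Projective (T.X₃.X n)) (F : C ⥤ D) [F.Additive] :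
    (T.map (F.mapHomologicalComplex (ComplexShape.down ℕ))).ShortExact :=
  shortExact_of_degreewise_shortExact _ fun n =>
    have : Projective ((T.map (eval C (ComplexShape.down ℕ) n)).X₃) := hP n
    ((hT.map_of_exact (eval C (ComplexShape.down ℕ) n)).splittingOfProjective.map F).shortExact

section HomologySequence

variable {T : ShortComplex (ChainComplex C ℕ)} (hT : T.ShortExact) (p : ℕ)
include hT

lemma isZero_homology_X₁_iff :
    IsZero (T.X₁.homology p) ↔ Epi (homologyMap T.g (p + 1)) ∧ Mono (homologyMap T.g p) := by
  refine ⟨fun h => ⟨?_, ?_⟩, fun ⟨_, _⟩ => ?_⟩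
  · exact (hT.homology_exact₃ (p + 1) p rfl).epi_f (h.eq_of_tgt _ _)
  · exact (hT.homology_exact₂ p).mono_g (h.eq_of_src _ _)
  · exact (exactAt_iff_isZero_homology _ _).1
      (hT.exactAt_X₁ p inferInstance fun | _, rfl => inferInstance)

lemma isZero_homology_X₃_iff :
    IsZero (T.X₃.homology (p + 1)) ↔
      Epi (homologyMap T.f (p + 1)) ∧ Mono (homologyMap T.f p) := by
  refine ⟨fun h => ⟨?_, ?_⟩, fun ⟨_, _⟩ => ?_⟩
  · exact (hT.homology_exact₂ (p + 1)).epi_f (h.eq_of_tgt _ _)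
  · exact (hT.homology_exact₁ (p + 1) p rfl).mono_g (h.eq_of_src _ _)
  · exact (exactAt_iff_isZero_homology _ _).1
      (hT.exactAt_X₃ (p + 1) inferInstance fun | _, rfl => inferInstance)

end HomologySequence

/-- A projective resolution of a short complex by a short exact sequence of complexes, as in the
horseshoe lemma. -/
structure ShortExactResolution (S : ShortComplex C) where
  res₁ : ProjectiveResolution S.X₁
  res₂ : ProjectiveResolution S.X₂
  res₃ : ProjectiveResolution S.X₃
  f : res₁.complex ⟶ res₂.complex
  g : res₂.complex ⟶ res₃.complex
  zero : f ≫ g = 0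
  shortExact : (ShortComplex.mk f g zero).ShortExact
  f_π : f ≫ res₂.π = res₁.π ≫ (ChainComplex.single₀ C).map S.f
  g_π : g ≫ res₃.π = res₂.π ≫ (ChainComplex.single₀ C).map S.g

lemma projective_homotopyCofiber {P Q : ChainComplex C ℕ} (φ : P ⟶ Q)
    [hP : ∀ n, Projective (P.X n)] [hQ : ∀ n, Projective (Q.X n)] (n : ℕ) :
    Projective ((homotopyCofiber φ).X n) := by
  rcases n with - | n
  · exact Projective.of_iso (homotopyCofiber.XIso φ 0 (by simp)).symm (hQ 0)
  · exact Projective.of_iso (homotopyCofiber.XIsoBiprod φ (n + 1) n rfl).symm inferInstance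

lemma quasiIso_biprod_fst (K : ChainComplex C ℕ) {L : ChainComplex C ℕ} (h : Homotopy (𝟙 L) 0) :
    QuasiIso (biprod.fst : K ⊞ L ⟶ K) :=
  let e : HomotopyEquiv (K ⊞ L) K :=
    { hom := biprod.fst
      inv := biprod.inl
      homotopyHomInvId :=
        (Homotopy.ofEq (by simp)).trans
          (((Homotopy.refl (biprod.fst ≫ biprod.inl)).add
            ((h.symm.compRight biprod.inr).compLeft biprod.snd)).trans (.ofEq (by simp)))
      homotopyInvHomId := .ofEq biprod.inl_fst }
  e.quasiIso_hom

lemma exists_splitMono_comp_quasiIso {P Q : ChainComplex C ℕ} (φ : P ⟶ Q)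
    [∀ n, Projective (P.X n)] [∀ n, Projective (Q.X n)] :
    ∃ (Q' : ChainComplex C ℕ) (i : P ⟶ Q') (q : Q' ⟶ Q), i ≫ q = φ ∧ QuasiIso q ∧
      (∀ n, IsSplitMono (i.f n)) ∧ ∀ n, Projective (Q'.X n) := by
  refine ⟨Q ⊞ homotopyCofiber (𝟙 P), biprod.lift φ (homotopyCofiber.inr _), biprod.fst,
    biprod.lift_fst _ _, quasiIso_biprod_fst Q (coneIdContraction P), fun n => ⟨⟨?_, ?_⟩⟩,
    fun n => ?_⟩
  · exact (biprod.snd : Q ⊞ homotopyCofiber (𝟙 P) ⟶ _).f n ≫ homotopyCofiber.sndX (𝟙 P) n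
  · simp [← comp_f_assoc]
  · have := projective_homotopyCofiber (𝟙 P) n
    exact Projective.of_iso ((eval C _ n).mapBiprod _ _).symm
      (inferInstanceAs (Projective (Q.X n ⊞ (homotopyCofiber (𝟙 P)).X n)))

lemma projective_X₃_of_isSplitMono {S : ShortComplex C} (hS : S.ShortExact) [IsSplitMono S.f]
    [Projective S.X₂] : Projective S.X₃ :=
  let s := ShortComplex.Splitting.ofExactOfRetraction S hS.exact (retraction S.f) (by simp) hS.epi_g
  (Retract.mk s.s S.g s.s_g).projective

lemma nonempty_shortExactResolution [EnoughProjectives C] {S : ShortComplex C} (hS : S.ShortExact) :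
    Nonempty (ShortExactResolution S) := by
  let P := ProjectiveResolution.of S.X₁
  let Q := ProjectiveResolution.of S.X₂
  obtain ⟨Q', i, q, hiq, hq, hi, hQ'⟩ :=
    exists_splitMono_comp_quasiIso (ProjectiveResolution.lift S.f P Q)
  have : Mono i := mono_of_mono_f _ fun n => inferInstance
  let T : ShortComplex (ChainComplex C ℕ) := ⟨i, cokernel.π i, cokernel.condition i⟩
  have hT : T.ShortExact := { exact := ShortComplex.exact_cokernel i }
  have hS₀ : (S.map (ChainComplex.single₀ C)).ShortExact := hS.map_of_exact (single C _ 0)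
  have comm : i ≫ q ≫ Q.π = P.π ≫ (ChainComplex.single₀ C).map S.f := by
    rw [reassoc_of% hiq, ProjectiveResolution.lift_commutes]
  have zero : i ≫ (q ≫ Q.π) ≫ (ChainComplex.single₀ C).map S.g = 0 := by
    rw [← Category.assoc, comm, Category.assoc, ← Functor.map_comp, S.zero, Functor.map_zero,
      comp_zero]
  let π₃ : cokernel i ⟶ (ChainComplex.single₀ C).obj S.X₃ := cokernel.desc i _ zero
  let π : T ⟶ S.map (ChainComplex.single₀ C) :=
    { τ₁ := P.π
      τ₂ := q ≫ Q.π
      τ₃ := π₃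
      comm₁₂ := comm.symm
      comm₂₃ := (cokernel.π_desc _ _ _).symm }
  have hπ₂ : QuasiIso (q ≫ Q.π) := inferInstance
  exact ⟨{
    res₁ := P
    res₂ := { complex := Q', projective := hQ', π := q ≫ Q.π }
    res₃ :=
      { complex := cokernel i
        projective := fun n =>
          have : IsSplitMono (T.map (eval C _ n)).f := hi n
          have : Projective (T.map (eval C _ n)).X₂ := hQ' n
          projective_X₃_of_isSplitMono (hT.map_of_exact (eval C _ n))
        π := π₃
        quasiIso := HomologySequence.quasiIso_τ₃ π hT hS₀ P.quasiIso hπ₂ }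
    f := i
    g := cokernel.π i
    zero := cokernel.condition i
    shortExact := hT
    f_π := comm
    g_π := cokernel.π_desc _ _ _ }⟩

section KernelCokernel

variable {X Y : C} (f : X ⟶ Y)

/-- The sequence `ker f ⟶ X ⟶ im f`. -/
noncomputable abbrev kernelImage : ShortComplex C :=
  .mk (kernel.ι f) (factorThruImage f) (by rw [← cancel_mono (image.ι f)]; simp)

/-- The sequence `im f ⟶ Y ⟶ coker f`. -/
noncomputable abbrev imageCokernel : ShortComplex C :=
  .mk (image.ι f) (cokernel.π f) (by rw [← cancel_epi (factorThruImage f)]; simp)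

lemma shortExact_kernelImage : (kernelImage f).ShortExact where
  exact := by
    let φ : kernelImage f ⟶ ShortComplex.mk _ _ (kernel.condition f) :=
      { τ₁ := 𝟙 _, τ₂ := 𝟙 _, τ₃ := image.ι f }
    have : Epi φ.τ₁ := inferInstanceAs (Epi (𝟙 _))
    have : IsIso φ.τ₂ := inferInstanceAs (IsIso (𝟙 _))
    have : Mono φ.τ₃ := inferInstanceAs (Mono (image.ι f))
    exact (ShortComplex.exact_iff_of_epi_of_isIso_of_mono φ).2 (ShortComplex.exact_kernel f)

lemma shortExact_imageCokernel : (imageCokernel f).ShortExact where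
  exact := by
    let φ : ShortComplex.mk _ _ (cokernel.condition f) ⟶ imageCokernel f :=
      { τ₁ := factorThruImage f, τ₂ := 𝟙 _, τ₃ := 𝟙 _ }
    have : Epi φ.τ₁ := inferInstanceAs (Epi (factorThruImage f))
    have : IsIso φ.τ₂ := inferInstanceAs (IsIso (𝟙 _))
    have : Mono φ.τ₃ := inferInstanceAs (Mono (𝟙 _))
    exact (ShortComplex.exact_iff_of_epi_of_isIso_of_mono φ).1 (ShortComplex.exact_cokernel f)

end KernelCokernel

section LeftDerived

variable [EnoughProjectives C] {S : ShortComplex C} (hS : S.ShortExact) (F : C ⥤ D) [F.Additive]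
  (p : ℕ)

lemma isZero_leftDerived_obj_of_preservesHomology [F.PreservesHomology] (X : C) :
    IsZero ((F.leftDerived (p + 1)).obj X) := by
  let P := ProjectiveResolution.of X
  have exactAt : ((F.mapHomologicalComplex _).obj P.complex).ExactAt (p + 1) :=
    (exactAt_iff' _ (p + 2) (p + 1) p (by simp) (by simp)).2 ((P.exact_succ p).map F)
  exact ((exactAt_iff_isZero_homology _ _).1 exactAt).of_iso (P.isoLeftDerivedObj F (p + 1))

/-- Left derived functors commute with postcomposition by an exact functor. -/
noncomputable def leftDerivedObjCompIso {A : Type w''} [Category.{v''} A] [Abelian A]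
    (E : D ⥤ A) [E.Additive] [E.PreservesHomology] (X : C) :
    E.obj ((F.leftDerived p).obj X) ≅ ((F ⋙ E).leftDerived p).obj X :=
  let P := ProjectiveResolution.of X
  E.mapIso (P.isoLeftDerivedObj F p) ≪≫
    ((((F.mapHomologicalComplex _).obj P.complex).sc p).mapHomologyIso E).symm ≪≫
    (P.isoLeftDerivedObj (F ⋙ E) p).symm

/-- The map `L_p F (f)` computed from a lift of `f` to chosen projective resolutions. -/
noncomputable def leftDerivedMapArrowIso {X Y : C} {f : X ⟶ Y} {P : ProjectiveResolution X}
    {Q : ProjectiveResolution Y} {φ : P.complex ⟶ Q.complex}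
    (hφ : φ ≫ Q.π = P.π ≫ (ChainComplex.single₀ C).map f) :
    Arrow.mk ((F.leftDerived p).map f) ≅
      Arrow.mk (homologyMap ((F.mapHomologicalComplex (ComplexShape.down ℕ)).map φ) p) :=
  Arrow.isoMk (P.isoLeftDerivedObj F p) (Q.isoLeftDerivedObj F p)
    (ProjectiveResolution.isoLeftDerivedObj_hom_naturality f P Q φ
      (by simpa using congr_hom hφ 0) F p).symm

lemma epi_leftDerived_map_iff {X Y : C} {f : X ⟶ Y} {P : ProjectiveResolution X}
    {Q : ProjectiveResolution Y} {φ : P.complex ⟶ Q.complex}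
    (hφ : φ ≫ Q.π = P.π ≫ (ChainComplex.single₀ C).map f) :
    Epi ((F.leftDerived p).map f) ↔
      Epi (homologyMap ((F.mapHomologicalComplex (ComplexShape.down ℕ)).map φ) p) :=
  (MorphismProperty.epimorphisms D).arrow_mk_iso_iff (leftDerivedMapArrowIso F p hφ)

lemma mono_leftDerived_map_iff {X Y : C} {f : X ⟶ Y} {P : ProjectiveResolution X}
    {Q : ProjectiveResolution Y} {φ : P.complex ⟶ Q.complex}
    (hφ : φ ≫ Q.π = P.π ≫ (ChainComplex.single₀ C).map f) :
    Mono ((F.leftDerived p).map f) ↔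
      Mono (homologyMap ((F.mapHomologicalComplex (ComplexShape.down ℕ)).map φ) p) :=
  (MorphismProperty.monomorphisms D).arrow_mk_iso_iff (leftDerivedMapArrowIso F p hφ)

include hS

lemma isZero_leftDerived_obj_X₁_iff :
    IsZero ((F.leftDerived p).obj S.X₁) ↔
      Epi ((F.leftDerived (p + 1)).map S.g) ∧ Mono ((F.leftDerived p).map S.g) := by
  obtain ⟨R⟩ := nonempty_shortExactResolution hS
  have hR := shortExact_map_mapHomologicalComplex R.shortExact R.res₃.projective F
  rw [(R.res₁.isoLeftDerivedObj F p).isZero_iff, epi_leftDerived_map_iff F (p + 1) R.g_π,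
    mono_leftDerived_map_iff F p R.g_π]
  exact isZero_homology_X₁_iff hR p

lemma isZero_leftDerived_obj_X₃_iff :
    IsZero ((F.leftDerived (p + 1)).obj S.X₃) ↔
      Epi ((F.leftDerived (p + 1)).map S.f) ∧ Mono ((F.leftDerived p).map S.f) := by
  obtain ⟨R⟩ := nonempty_shortExactResolution hS
  have hR := shortExact_map_mapHomologicalComplex R.shortExact R.res₃.projective F
  rw [(R.res₃.isoLeftDerivedObj F (p + 1)).isZero_iff,
    epi_leftDerived_map_iff F (p + 1) R.f_π, mono_leftDerived_map_iff F p R.f_π]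
  exact isZero_homology_X₃_iff hR p

lemma epi_leftDerived_zero_map_g : Epi ((F.leftDerived 0).map S.g) := by
  obtain ⟨R⟩ := nonempty_shortExactResolution hS
  have hR := shortExact_map_mapHomologicalComplex R.shortExact R.res₃.projective F
  rw [epi_leftDerived_map_iff F 0 R.g_π]
  have : Epi (((F.mapHomologicalComplex (ComplexShape.down ℕ)).map R.g).f 0) :=
    (hR.map_of_exact (eval D _ 0)).epi_g
  exact epi_homologyMap_of_epi_of_not_rel _ 0 (by simp)

omit hS

section KernelCokernel

variable {X Y : C} {f : X ⟶ Y}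

lemma leftDerived_map_factorThruImage_comp : (F.leftDerived p).map (factorThruImage f) ≫
    (F.leftDerived p).map (image.ι f) = (F.leftDerived p).map f := by
  rw [← Functor.map_comp, image.fac]

lemma epi_mono_leftDerived_map_of_isZero (hK : IsZero ((F.leftDerived p).obj (kernel f)))
    (hD : IsZero ((F.leftDerived (p + 1)).obj (cokernel f))) :
    Epi ((F.leftDerived (p + 1)).map f) ∧ Mono ((F.leftDerived p).map f) := by
  obtain ⟨_, _⟩ := (isZero_leftDerived_obj_X₁_iff (shortExact_kernelImage f) F p).1 hK
  obtain ⟨_, _⟩ := (isZero_leftDerived_obj_X₃_iff (shortExact_imageCokernel f) F p).1 hD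
  rw [← leftDerived_map_factorThruImage_comp F (p + 1), ← leftDerived_map_factorThruImage_comp F p]
  exact ⟨epi_comp _ _, mono_comp _ _⟩

lemma isZero_leftDerived_one_cokernel [Epi ((F.leftDerived 1).map f)]
    [Mono ((F.leftDerived 0).map f)] : IsZero ((F.leftDerived 1).obj (cokernel f)) := by
  have : Epi ((F.leftDerived 0).map (factorThruImage f)) :=
    epi_leftDerived_zero_map_g (shortExact_kernelImage f) F
  have : Mono ((F.leftDerived 0).map (factorThruImage f)) :=
    mono_of_mono_fac (leftDerived_map_factorThruImage_comp F 0)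
  have := isIso_of_mono_of_epi ((F.leftDerived 0).map (factorThruImage f))
  refine (isZero_leftDerived_obj_X₃_iff (shortExact_imageCokernel f) F 0).2
    ⟨epi_of_epi_fac (leftDerived_map_factorThruImage_comp F 1), ?_⟩
  rwa [← mono_comp_iff_of_isIso ((F.leftDerived 0).map (factorThruImage f)),
    leftDerived_map_factorThruImage_comp]

lemma isZero_leftDerived_zero_kernel [Epi ((F.leftDerived 1).map f)]
    [Mono ((F.leftDerived 0).map f)] (hD : IsZero ((F.leftDerived 2).obj (cokernel f))) :
    IsZero ((F.leftDerived 0).obj (kernel f)) := by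
  have : Epi ((F.leftDerived 1).map (image.ι f)) :=
    epi_of_epi_fac (leftDerived_map_factorThruImage_comp F 1)
  have : Mono ((F.leftDerived 1).map (image.ι f)) :=
    ((isZero_leftDerived_obj_X₃_iff (shortExact_imageCokernel f) F 1).1 hD).2
  have := isIso_of_mono_of_epi ((F.leftDerived 1).map (image.ι f))
  refine (isZero_leftDerived_obj_X₁_iff (shortExact_kernelImage f) F 0).2
    ⟨?_, mono_of_mono_fac (leftDerived_map_factorThruImage_comp F 0)⟩
  rwa [← epi_comp_iff_of_isIso _ ((F.leftDerived 1).map (image.ι f)),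
    leftDerived_map_factorThruImage_comp]

end KernelCokernel

end LeftDerived

end DerivedLongExactSequence

namespace FI

/-- The functor `T ↦ T ⊔ {∗}` from FI to itself. -/
def shift : FI ⥤ FI where
  obj T := ⟨Option T⟩
  map f := Function.Embedding.optionMap f
  map_id T := Function.Embedding.ext fun x => by cases x <;> rfl
  map_comp f g := Function.Embedding.ext fun x => by cases x <;> rfl

/-- The inclusion of `T` into `T ⊔ {∗}`. -/
def incl (T : FI) : T ⟶ shift.obj T := (Function.Embedding.some : T ↪ Option T)

lemma incl_naturality {S T : FI} (f : S ⟶ T) : f ≫ incl T = incl S ≫ shift.map f := rfl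

/-- A set with `n` elements, chosen so that `iter (n + 1)` is definitionally a shift. -/
def iter : ℕ → FI
  | 0 => ⟨Empty⟩
  | n + 1 => shift.obj (iter n)

lemma card_shift (T : FI) : Nat.card (shift.obj T) = Nat.card T + 1 :=
  Finite.card_option

lemma card_iter (n : ℕ) : Nat.card (iter n) = n := by
  induction n with
  | zero => exact Nat.card_of_isEmpty (α := Empty)
  | succ n ih => exact (card_shift _).trans (congrArg (· + 1) ih)

lemma nonempty_iso_of_card_eq {S T : FI} (h : Nat.card S = Nat.card T) : Nonempty (S ≅ T) := by
  obtain ⟨e⟩ := Finite.card_eq.1 h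
  exact ⟨⟨e.toEmbedding, e.symm.toEmbedding,
    Function.Embedding.ext e.symm_apply_apply, Function.Embedding.ext e.apply_symm_apply⟩⟩

lemma exists_eq_incl_comp {S T : FI} (f : S ⟶ T) (h : Nat.card S < Nat.card T) :
    ∃ g : shift.obj S ⟶ T, f = incl S ≫ g := by
  obtain ⟨t, ht⟩ : ∃ t : T, t ∉ Set.range (show S ↪ T from f) := by
    by_contra! hs
    exact h.not_ge (Nat.card_le_card_of_surjective (show S ↪ T from f) hs)
  exact ⟨Function.Embedding.optionElim (show S ↪ T from f) t ht, rfl⟩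

/-- The set `S` with the point `o` removed, or `S` itself (up to isomorphism) if `o = none`. -/
def erase (S : FI) (o : Option S) : FI := ⟨{x : S // some x ≠ o}⟩

/-- The inclusion of `S` with a point removed into `S`. -/
def eraseIncl (S : FI) (o : Option S) : S.erase o ⟶ S := Function.Embedding.subtype _

/-- The inverse of `eraseIncl S none`. -/
def toEraseNone (S : FI) : S ⟶ S.erase none :=
  (⟨fun x => ⟨x, Option.some_ne_none x⟩, fun _ _ h => congrArg Subtype.val h⟩ :
    S ↪ {x : S // some x ≠ none})

lemma toEraseNone_comp_eraseIncl (S : FI) : S.toEraseNone ≫ S.eraseIncl none = 𝟙 S := rfl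

lemma card_erase_some (S : FI) (a : S) : Nat.card (S.erase (some a)) + 1 = Nat.card S := by
  classical
  let e : {x : S // some x ≠ some a} ≃ {x : S // x ≠ a} :=
    Equiv.subtypeEquivRight fun x => (Option.some_inj).not
  exact (Finite.card_option (α := S.erase (some a))).symm.trans
    (Nat.card_congr ((Equiv.optionCongr e).trans (Equiv.optionSubtypeNe a)))

open Classical in
/-- The injection of `S` into `(S ∖ {o}) ⊔ {∗}` that sends `o` to the added point. -/
noncomputable def toShiftErase (S : FI) (o : Option S) : S ⟶ shift.obj (S.erase o) :=
  (⟨fun x => if h : some x ≠ o then some ⟨x, h⟩ else none, by grind [Function.Injective]⟩ :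
    S ↪ Option {x : S // some x ≠ o})

section

variable {S T : FI} (o : Option S) (g : S.erase o ⟶ T)

open Classical in
lemma toShiftErase_comp_apply_eq_none_iff (x : S) :
    (show S ↪ Option T from S.toShiftErase o ≫ shift.map g) x = none ↔ some x = o :=
  Option.map_eq_none_iff.trans (dite_eq_right_iff.trans (by simp))

lemma toShiftErase_comp_apply (x : S.erase o) :
    (show S ↪ Option T from S.toShiftErase o ≫ shift.map g) x.1 =
      some ((show S.erase o ↪ T from g) x) :=
  congrArg (Option.map _) (dif_pos x.2)

end

lemma toShiftErase_none_comp (S : FI) :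
    S.toShiftErase none ≫ shift.map (S.eraseIncl none) = S.incl :=
  Function.Embedding.ext fun x =>
    toShiftErase_comp_apply none (S.eraseIncl none) ⟨x, Option.some_ne_none x⟩

lemma toShiftErase_comp_bijective (S T : FI) : Function.Bijective
    fun c : Σ o : Option S, (S.erase o ⟶ T) => S.toShiftErase c.1 ≫ shift.map c.2 := by
  constructor
  · rintro ⟨o, g⟩ ⟨o', g'⟩ (h : S.toShiftErase o ≫ shift.map g = S.toShiftErase o' ≫ shift.map g')
    obtain rfl : o = o' := Option.ext fun x => by
      rw [eq_comm, ← toShiftErase_comp_apply_eq_none_iff o g, h,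
        toShiftErase_comp_apply_eq_none_iff, eq_comm]
    refine congrArg (Sigma.mk o) (Function.Embedding.ext fun x => Option.some_injective _ ?_)
    rw [← toShiftErase_comp_apply, h, toShiftErase_comp_apply]
  · intro f
    let f' : S ↪ Option T := f
    obtain ⟨o, ho⟩ : ∃ o : Option S, ∀ x, f' x = none ↔ some x = o := by
      by_cases h : ∃ a, f' a = none
      · obtain ⟨a, ha⟩ := h
        exact ⟨some a, fun x => by rw [← ha, f'.injective.eq_iff, Option.some_inj]⟩
      · exact ⟨none, fun x => by simpa using fun hx => h ⟨x, hx⟩⟩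
    have isSome (x : S.erase o) : ∃ t, f' x.1 = some t :=
      Option.ne_none_iff_exists'.1 ((ho x.1).not.2 x.2)
    choose g hg using isSome
    refine ⟨⟨o, (⟨g, fun x y hxy => Subtype.ext (f'.injective (by rw [hg, hg, hxy]))⟩ :
      S.erase o ↪ T)⟩, Function.Embedding.ext fun x => ?_⟩
    by_cases hx : some x = o
    · exact ((toShiftErase_comp_apply_eq_none_iff o _ x).2 hx).trans ((ho x).2 hx).symm
    · exact (toShiftErase_comp_apply o _ ⟨x, hx⟩).trans (hg ⟨x, hx⟩).symm

/-- An injection into `T ⊔ {∗}` amounts to the preimage of the added point, if there is one, and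
an injection of the rest into `T`. -/
noncomputable def homShiftEquiv (S T : FI) :
    (Σ o : Option S, (S.erase o ⟶ T)) ≃ (S ⟶ shift.obj T) :=
  Equiv.ofBijective _ (toShiftErase_comp_bijective S T)

end FI

namespace FIModule

open Limits HomologicalComplex

variable {R : Type} [CommRing R]

lemma map_comp_hom_apply (V : FIModule.{u} R) {S T U : FI} (f : S ⟶ T) (g : T ⟶ U)
    (x : V.obj S) : (V.map (f ≫ g)).hom x = (V.map g).hom ((V.map f).hom x) := by
  rw [V.map_comp]; rfl

variable (R) in
/-- The shift functor on FI-modules: `(SV)_T = V_{T ⊔ {∗}}`. -/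
abbrev shift : FIModule.{u} R ⥤ FIModule.{u} R :=
  (Functor.whiskeringLeft FI FI (ModuleCat.{u} R)).obj FI.shift

/-- The natural map from an FI-module to its shift. -/
def toShift : 𝟭 (FIModule.{u} R) ⟶ shift R where
  app V :=
    { app := fun T => V.map (FI.incl T)
      naturality := fun S T f => by
        change V.map f ≫ V.map _ = V.map _ ≫ V.map (FI.shift.map f)
        rw [← V.map_comp, ← V.map_comp, FI.incl_naturality] }
  naturality V W φ := by
    ext T : 2
    exact (φ.naturality (FI.incl T)).symm

section Free

variable {ι : Type u} (A : ι → FI)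

variable (R) in
/-- The direct sum of the representable FI-modules `R[Hom(A i, -)]`. -/
noncomputable def freeOn : FIModule.{u} R where
  obj T := ModuleCat.of R ((Σ i, A i ⟶ T) →₀ R)
  map g := ModuleCat.ofHom (Finsupp.lmapDomain R R fun a => ⟨a.1, a.2 ≫ g⟩)
  map_id T := by
    ext a
    simp
  map_comp f g := by
    ext a
    simp

variable (R) in
/-- The basis element of `freeOn R A` given by `f : A i ⟶ T`. -/
noncomputable def freeOnSingle {T : FI} (i : ι) (f : A i ⟶ T) : (freeOn R A).obj T :=
  Finsupp.single (⟨i, f⟩ : Σ i, A i ⟶ T) (1 : R)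

variable {A}

lemma freeOn_map_single {T T' : FI} (g : T ⟶ T') (i : ι) (f : A i ⟶ T) :
    ((freeOn R A).map g).hom (freeOnSingle R A i f) = freeOnSingle R A i (f ≫ g) :=
  Finsupp.mapDomain_single

/-- The map out of `freeOn R A` that sends the generator `𝟙 (A i)` to `v i`. -/
noncomputable def freeOnLift {X : FIModule.{u} R} (v : ∀ i, X.obj (A i)) : freeOn R A ⟶ X where
  app T := ModuleCat.ofHom (Finsupp.linearCombination R fun a => (X.map a.2).hom (v a.1))
  naturality {T T'} g := by
    apply ModuleCat.hom_ext
    refine Finsupp.lhom_ext' fun a => LinearMap.ext_ring ?_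
    simp [freeOn]

lemma freeOnLift_single {X : FIModule.{u} R} (v : ∀ i, X.obj (A i)) {T : FI} (i : ι)
    (f : A i ⟶ T) : ((freeOnLift v).app T).hom (freeOnSingle R A i f) = (X.map f).hom (v i) :=
  (Finsupp.linearCombination_single _ _ _).trans (one_smul R _)

lemma freeOn_hom_ext {X : FIModule.{u} R} {φ ψ : freeOn R A ⟶ X}
    (h : ∀ i, (φ.app (A i)).hom (freeOnSingle R A i (𝟙 _)) =
      (ψ.app (A i)).hom (freeOnSingle R A i (𝟙 _))) : φ = ψ := by
  ext T : 2
  apply ModuleCat.hom_ext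
  refine Finsupp.lhom_ext' fun ⟨i, f⟩ => LinearMap.ext_ring ?_
  have key (χ : freeOn R A ⟶ X) : (χ.app T).hom (freeOnSingle R A i f) =
      (X.map f).hom ((χ.app (A i)).hom (freeOnSingle R A i (𝟙 _))) := by
    rw [← Category.id_comp f, ← freeOn_map_single, Category.id_comp]
    exact NatTrans.naturality_apply χ f _
  exact (key φ).trans ((congrArg _ (h i)).trans (key ψ).symm)

instance : Projective (freeOn R A) where
  factors {E X} f e _ := by
    choose s hs using fun T => app_surjective_of_epi e T
    refine ⟨freeOnLift fun i => s _ ((f.app (A i)).hom (freeOnSingle R A i (𝟙 _))),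
      freeOn_hom_ext fun i => ?_⟩
    refine Eq.trans (congrArg (e.app (A i)).hom (freeOnLift_single _ i (𝟙 _))) ?_
    rw [CategoryTheory.Functor.map_id]
    exact hs _ _

lemma exists_retract_freeOn (P : FIModule.{u} R) [Projective P] :
    ∃ (ι : Type u) (A : ι → FI), Nonempty (Retract P (freeOn R A)) := by
  let A : (Σ n, P.obj (FI.std n)) → FI := fun a => FI.std a.1
  let π : freeOn R A ⟶ P := freeOnLift fun a => a.2
  have (T : FI) : Epi (π.app T) := by
    refine (ModuleCat.epi_iff_surjective _).2 fun x => ?_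
    obtain ⟨n, ⟨e⟩⟩ := exists_iso_std T
    refine ⟨freeOnSingle R A ⟨n, (P.map e.inv).hom x⟩ e.hom, (freeOnLift_single _ _ _).trans ?_⟩
    exact ConcreteCategory.congr_hom (P.mapIso e).inv_hom_id x
  have : Epi π := NatTrans.epi_of_epi_app _
  exact ⟨_, A, ⟨⟨Projective.factorThru (𝟙 P) π, π, Projective.factorThru_comp _ _⟩⟩⟩

variable (A)

/-- The sets obtained from the `A i` by removing at most one point. -/
abbrev eraseFamily (a : Σ i, Option (A i)) : FI := (A a.1).erase a.2

variable (R) in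
/-- The shift of a free FI-module is free. -/
noncomputable def freeOnEraseIso : freeOn R (eraseFamily A) ≅ (shift R).obj (freeOn R A) :=
  NatIso.ofComponents
    (fun T => (Finsupp.domLCongr ((Equiv.sigmaAssoc fun i (o : Option (A i)) =>
      ((A i).erase o ⟶ T)).trans
        (Equiv.sigmaCongrRight fun i => FI.homShiftEquiv (A i) T))).toModuleIso)
    fun {T T'} g => by
      apply ModuleCat.hom_ext
      refine Finsupp.lhom_ext' fun a => LinearMap.ext_ring ?_
      change Finsupp.domLCongr (R := R) _ (Finsupp.mapDomain _ (Finsupp.single a 1)) =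
        Finsupp.mapDomain _ (Finsupp.domLCongr (R := R) _ (Finsupp.single a 1))
      rw [Finsupp.mapDomain_single, Finsupp.domLCongr_single, Finsupp.domLCongr_single,
        Finsupp.mapDomain_single]
      have h : (A a.1.1).toShiftErase a.1.2 ≫ FI.shift.map (a.2 ≫ g) =
          ((A a.1.1).toShiftErase a.1.2 ≫ FI.shift.map a.2) ≫ FI.shift.map g := by
        rw [FI.shift.map_comp, Category.assoc]
      exact congrArg (fun f => freeOnSingle R A a.1.1 f) h

lemma freeOnEraseIso_hom_single {T : FI} (i : ι) (o : Option (A i)) (f : (A i).erase o ⟶ T) :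
    ((freeOnEraseIso R A).hom.app T).hom (freeOnSingle R (eraseFamily A) ⟨i, o⟩ f) =
      freeOnSingle R A i ((A i).toShiftErase o ≫ FI.shift.map f) :=
  Finsupp.domLCongr_single _ _ _

lemma isSplitMono_toShift_freeOn : IsSplitMono (toShift.app (freeOn R A)) := by
  let j : freeOn R A ⟶ freeOn R (eraseFamily A) :=
    freeOnLift fun i => freeOnSingle R (eraseFamily A) ⟨i, none⟩ ((A i).eraseIncl none)
  let r : freeOn R (eraseFamily A) ⟶ freeOn R A := freeOnLift fun
    | ⟨i, none⟩ => freeOnSingle R A i (A i).toEraseNone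
    | ⟨_, some _⟩ => 0
  have hr : j ≫ r = 𝟙 _ := freeOn_hom_ext fun i => calc
    (r.app _).hom ((j.app (A i)).hom (freeOnSingle R A i (𝟙 _)))
    _ = (r.app _).hom (freeOnSingle R (eraseFamily A) ⟨i, none⟩ ((A i).eraseIncl none)) := by
      rw [freeOnLift_single, (freeOn R _).map_id]; rfl
    _ = freeOnSingle R A i (𝟙 _) := by
      rw [freeOnLift_single, freeOn_map_single, FI.toEraseNone_comp_eraseIncl]
  have hj : j ≫ (freeOnEraseIso R A).hom = toShift.app (freeOn R A) := freeOn_hom_ext fun i => calc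
    ((freeOnEraseIso R A).hom.app (A i)).hom ((j.app (A i)).hom (freeOnSingle R A i (𝟙 _)))
    _ = ((freeOnEraseIso R A).hom.app (A i)).hom
        (freeOnSingle R (eraseFamily A) ⟨i, none⟩ ((A i).eraseIncl none)) := by
      rw [freeOnLift_single, (freeOn R _).map_id]; rfl
    _ = freeOnSingle R A i (A i).incl := by
      rw [freeOnEraseIso_hom_single, FI.toShiftErase_none_comp]
    _ = ((freeOn R A).map (A i).incl).hom (freeOnSingle R A i (𝟙 _)) := by
      rw [freeOn_map_single, Category.id_comp]
  rw [← hj]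
  have : IsSplitMono j := ⟨⟨r, hr⟩⟩
  infer_instance

end Free

instance : (shift.{u} R).PreservesProjectiveObjects where
  projective_obj {P} hP := by
    obtain ⟨ι, A, ⟨r⟩⟩ := exists_retract_freeOn P
    have := Projective.of_iso (freeOnEraseIso R A) inferInstance
    exact (r.map (shift R)).projective

instance (P : FIModule.{u} R) [Projective P] : IsSplitMono (toShift.app P) := by
  obtain ⟨ι, A, ⟨r⟩⟩ := exists_retract_freeOn P
  have := isSplitMono_toShift_freeOn (R := R) A
  exact ⟨⟨(shift R).map r.i ≫ retraction (toShift.app (freeOn R A)) ≫ r.r, by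
    rw [← toShift.naturality_assoc, IsSplitMono.id_assoc]
    exact r.retract⟩⟩

section Lower

variable (V : FIModule.{u} R)

lemma subsingleton_obj_of_card_eq {S T : FI} (h : Nat.card S = Nat.card T)
    [Subsingleton (V.obj S)] : Subsingleton (V.obj T) :=
  have ⟨e⟩ := FI.nonempty_iso_of_card_eq h
  (V.mapIso e).symm.toLinearEquiv.toEquiv.subsingleton

lemma map_mem_lower {S T : FI} (f : S ⟶ T) (h : Nat.card S < Nat.card T) (x : V.obj S) :
    (V.map f).hom x ∈ V.lower T :=
  Submodule.subset_span ⟨S, f, x, h, rfl⟩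

lemma lower_eq_bot {T : FI} (h : ∀ S : FI, Nat.card S < Nat.card T → Subsingleton (V.obj S)) :
    V.lower T = ⊥ := by
  refine Submodule.span_eq_bot.2 ?_
  rintro _ ⟨S, f, y, hS, rfl⟩
  rw [(h S hS).elim y 0, map_zero]

lemma lower_shift_obj (T : FI) :
    V.lower (FI.shift.obj T) =
      ((shift R).obj V).lower T ⊔ LinearMap.range (V.map T.incl).hom := by
  apply le_antisymm
  · refine Submodule.span_le.2 ?_
    rintro _ ⟨S, f, y, h, rfl⟩
    obtain ⟨⟨o, g⟩, rfl⟩ := (FI.toShiftErase_comp_bijective S T).2 f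
    dsimp only
    rcases o with - | a
    · refine Submodule.mem_sup_right ⟨(V.map (S.toEraseNone ≫ g)).hom y, ?_⟩
      rw [← map_comp_hom_apply, Category.assoc, FI.incl_naturality]
      rfl
    · refine Submodule.mem_sup_left ?_
      rw [map_comp_hom_apply]
      refine map_mem_lower ((shift R).obj V) g ?_ _
      have := S.card_erase_some a
      rw [FI.card_shift] at h
      omega
  · refine sup_le (Submodule.span_le.2 ?_) ?_
    · rintro _ ⟨S, f, y, h, rfl⟩
      exact map_mem_lower V (FI.shift.map f) (by rw [FI.card_shift, FI.card_shift]; omega) y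
    · rintro _ ⟨y, rfl⟩
      exact map_mem_lower V _ (by rw [FI.card_shift]; omega) y

lemma lower_shift_le_lower (T : FI) :
    ((shift R).obj V).lower T ≤ V.lower (FI.shift.obj T) :=
  le_sup_left.trans (V.lower_shift_obj T).ge

variable {V}

lemma app_injective_of_mono {W : FIModule.{u} R} (i : V ⟶ W) [Mono i] (T : FI) :
    Function.Injective (i.app T) :=
  (ModuleCat.mono_iff_injective _).1 inferInstance

lemma app_exact_of_exact {S : ShortComplex (FIModule.{u} R)} (h : S.Exact) (T : FI) :
    Function.Exact (S.f.app T) (S.g.app T) :=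
  (ShortComplex.ShortExact.moduleCat_exact_iff_function_exact _).1
    (h.map ((evaluation FI (ModuleCat.{u} R)).obj T))

lemma map_lower_of_epi {W : FIModule.{u} R} (φ : V ⟶ W) [Epi φ] (T : FI) :
    (V.lower T).map (φ.app T).hom = W.lower T := by
  refine le_antisymm (Submodule.map_le_iff_le_comap.2 (lower_le_comap_app φ T))
    (Submodule.span_le.2 ?_)
  rintro _ ⟨S, f, y, hS, rfl⟩
  obtain ⟨x, rfl⟩ := app_surjective_of_epi φ S y
  exact ⟨(V.map f).hom x, map_mem_lower V f hS x, NatTrans.naturality_apply φ f x⟩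

end Lower

variable (R) in
/-- The functor `V ↦ H₀(V)_T`. -/
abbrev H0At (T : FI) : FIModule.{u} R ⥤ ModuleCat.{u} R :=
  H0 R ⋙ (evaluation FI (ModuleCat.{u} R)).obj T

instance (T : FI) : PreservesFiniteColimits (H0At.{u} R T) :=
  (Functor.preservesFiniteColimits_iff_forall_exact_map_and_epi _).2 fun S hS => by
    have := hS.epi_g
    have hf := app_exact_of_exact hS.exact T
    constructor
    · refine (ShortComplex.ShortExact.moduleCat_exact_iff_function_exact _).2
        ((Function.Exact.exact_mapQ_iff hf (lower_le_comap_app S.f T)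
          (lower_le_comap_app S.g T)).2 ?_)
      exact inf_le_right.trans (map_lower_of_epi S.g T).ge
    · have surj := (Submodule.mkQ_surjective (S.X₃.lower T)).comp (app_surjective_of_epi S.g T)
      exact (ModuleCat.epi_iff_surjective _).2 (surj.of_comp (g := (S.X₂.lower T).mkQ))

variable (R) in
/-- The functor `V ↦ H_p(V)_n`, where `n` stands for the set `FI.iter n`. -/
noncomputable abbrev HAt (n p : ℕ) : FIModule.{u} R ⥤ ModuleCat.{u} R :=
  (H0At R (FI.iter n)).leftDerived p

lemma isZero_HAt_iff (n p : ℕ) (V : FIModule.{u} R) :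
    IsZero ((HAt R n p).obj V) ↔ Subsingleton (((H R p).obj V).obj (FI.iter n)) := by
  rw [← ModuleCat.isZero_iff_subsingleton]
  exact (leftDerivedObjCompIso (H0 R) p ((evaluation FI (ModuleCat.{u} R)).obj (FI.iter n))
    V).symm.isZero_iff

lemma isZero_HAt_zero_iff (n : ℕ) (V : FIModule.{u} R) :
    IsZero ((HAt R n 0).obj V) ↔ V.lower (FI.iter n) = ⊤ := by
  rw [((H0At R (FI.iter n)).leftDerivedZeroIsoSelf.app V).isZero_iff,
    ModuleCat.isZero_iff_subsingleton]
  exact Submodule.Quotient.subsingleton_iff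

lemma lower_iter_zero (V : FIModule.{u} R) : V.lower (FI.iter 0) = ⊥ :=
  V.lower_eq_bot fun S hS => absurd hS (by simp [FI.card_iter])

lemma isZero_HAt_zero_succ (p : ℕ) (V : FIModule.{u} R) :
    IsZero ((HAt R 0 (p + 1)).obj V) := by
  let e : H0At R (FI.iter 0) ≅ (evaluation FI (ModuleCat.{u} R)).obj (FI.iter 0) :=
    NatIso.ofComponents
      (fun V => (Submodule.quotEquivOfEqBot _ V.lower_iter_zero).toModuleIso) fun φ => by
        apply ModuleCat.hom_ext
        exact Submodule.linearMap_qext _ (LinearMap.ext fun x => rfl)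
  have : (H0At.{u} R (FI.iter 0)).PreservesHomology :=
    have := preservesFiniteLimits_of_natIso e.symm
    inferInstance
  exact isZero_leftDerived_obj_of_preservesHomology _ p V

section ShiftSequence

variable (R) (T : FI)

/-- The natural surjection `H₀(SV)_T ⟶ H₀(V)_{T ⊔ {∗}}`. -/
def H0AtShiftMap : shift.{u} R ⋙ H0At R T ⟶ H0At R (FI.shift.obj T) where
  app V := ModuleCat.ofHom (Submodule.factor (p := ((shift R).obj V).lower T)
    (p' := V.lower (FI.shift.obj T)) (V.lower_shift_le_lower T))
  naturality V W φ := by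
    apply ModuleCat.hom_ext
    exact Submodule.linearMap_qext _ (LinearMap.ext fun x => rfl)

/-- The natural sequence `H₀(V)_T ⟶ H₀(SV)_T ⟶ H₀(V)_{T ⊔ {∗}}` induced by `V ⟶ SV`. -/
def H0AtShiftSequence : ShortComplex (FIModule.{u} R ⥤ ModuleCat.{u} R) where
  X₁ := H0At R T
  X₂ := shift R ⋙ H0At R T
  X₃ := H0At R (FI.shift.obj T)
  f := Functor.whiskerRight toShift (H0At R T)
  g := H0AtShiftMap R T
  zero := by
    ext V : 2
    apply ModuleCat.hom_ext
    refine Submodule.linearMap_qext _ (LinearMap.ext fun x => ?_)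
    exact (Submodule.Quotient.mk_eq_zero _).2
      (map_mem_lower V T.incl (by rw [FI.card_shift]; omega) x)

/-- `H0AtShiftSequence` applied to a chain complex. -/
noncomputable def H0AtShiftComplex (P : ChainComplex (FIModule.{u} R) ℕ) :
    ShortComplex (ChainComplex (ModuleCat.{u} R) ℕ) where
  X₁ := ((H0At R T).mapHomologicalComplex _).obj P
  X₂ := ((H0At R T).mapHomologicalComplex _).obj (((shift R).mapHomologicalComplex _).obj P)
  X₃ := ((H0At R (FI.shift.obj T)).mapHomologicalComplex _).obj P
  f := ((H0At R T).mapHomologicalComplex _).map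
    ((NatTrans.mapHomologicalComplex toShift (ComplexShape.down ℕ)).app P)
  g := (NatTrans.mapHomologicalComplex (H0AtShiftMap R T) (ComplexShape.down ℕ)).app P
  zero := by
    ext n : 1
    exact NatTrans.congr_app (H0AtShiftSequence R T).zero (P.X n)

variable {R}

lemma exact_H0AtShiftSequence (V : FIModule.{u} R) :
    ((H0AtShiftSequence R T).map ((evaluation _ _).obj V)).Exact := by
  rw [ShortComplex.moduleCat_exact_iff_range_eq_ker]
  refine (Submodule.range_mapQ _ _ _ (lower_le_comap_app (toShift.app V) T)).trans
    (.trans ?_ (Submodule.ker_mapQ _ _ _ (V.lower_shift_le_lower T)).symm)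
  rw [Submodule.comap_id, lower_shift_obj, Submodule.map_sup, Submodule.mkQ_map_self, bot_sup_eq]
  rfl

instance (V : FIModule.{u} R) : Epi ((H0AtShiftMap R T).app V) :=
  (ModuleCat.epi_iff_surjective _).2 (Submodule.factor_surjective (V.lower_shift_le_lower T))

lemma shortExact_H0AtShiftSequence (P : FIModule.{u} R) [Projective P] :
    ((H0AtShiftSequence R T).map ((evaluation _ _).obj P)).ShortExact where
  exact := exact_H0AtShiftSequence T P
  mono_f := inferInstanceAs (Mono ((H0At R T).map (toShift.app P)))
  epi_g := inferInstanceAs (Epi ((H0AtShiftMap R T).app P))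

lemma shortExact_H0AtShiftComplex (P : ChainComplex (FIModule.{u} R) ℕ)
    [∀ n, Projective (P.X n)] : (H0AtShiftComplex R T P).ShortExact :=
  shortExact_of_degreewise_shortExact _ fun n => shortExact_H0AtShiftSequence T (P.X n)

end ShiftSequence

lemma isZero_HAt_succ_iff (n p : ℕ) (V : FIModule.{u} R) :
    IsZero ((HAt R (n + 1) (p + 1)).obj V) ↔
      Epi ((HAt R n (p + 1)).map (toShift.app V)) ∧ Mono ((HAt R n p).map (toShift.app V)) := by
  let P := ProjectiveResolution.of V
  let Q := (shift.{u} R).mapProjectiveResolution P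
  let φ : P.complex ⟶ Q.complex :=
    (NatTrans.mapHomologicalComplex toShift (ComplexShape.down ℕ)).app P.complex
  have hφ : φ ≫ Q.π = P.π ≫ (ChainComplex.single₀ _).map (toShift.app V) := by
    ext : 1
    change (toShift.app (P.complex.X 0) ≫ (shift R).map (P.π.f 0) ≫ _) = _
    simpa using! (toShift.naturality (P.π.f 0)).symm
  rw [epi_leftDerived_map_iff (H0At R (FI.iter n)) (p + 1) hφ,
    mono_leftDerived_map_iff (H0At R (FI.iter n)) p hφ,
    (P.isoLeftDerivedObj (H0At R (FI.iter (n + 1))) (p + 1)).isZero_iff]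
  exact isZero_homology_X₃_iff (shortExact_H0AtShiftComplex (FI.iter n) P.complex) p

lemma isZero_HAt_of_subsingleton_obj {n p : ℕ} {V : FIModule.{u} R}
    (h : ∀ T : FI, Nat.card T + p = n → Subsingleton (V.obj T)) :
    IsZero ((HAt R n p).obj V) := by
  induction n generalizing p V with
  | zero =>
    cases p with
    | zero =>
      have := h (FI.iter 0) (FI.card_iter 0)
      exact (isZero_HAt_zero_iff 0 V).2 (Subsingleton.elim _ _)
    | succ p => exact isZero_HAt_zero_succ p V
  | succ n ih =>
    cases p with
    | zero =>
      have := h (FI.iter (n + 1)) (FI.card_iter _)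
      exact (isZero_HAt_zero_iff (n + 1) V).2 (Subsingleton.elim _ _)
    | succ p =>
      rw [isZero_HAt_succ_iff]
      have source : IsZero ((HAt R n p).obj V) := ih fun T hT => h T (by omega)
      have target : IsZero ((HAt R n (p + 1)).obj ((shift R).obj V)) :=
        ih fun T hT => h (FI.shift.obj T) (by rw [FI.card_shift]; omega)
      exact ⟨⟨fun _ _ _ => target.eq_of_src _ _⟩, ⟨fun _ _ _ => source.eq_of_tgt _ _⟩⟩

lemma subsingleton_obj_of_forall_isZero {V : FIModule.{u} R}
    (h : ∀ n, IsZero ((HAt R n 0).obj V)) (T : FI) : Subsingleton (V.obj T) := by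
  induction hn : Nat.card T using Nat.strong_induction_on generalizing T with
  | _ n ih =>
    have bot : V.lower (FI.iter n) = ⊥ := V.lower_eq_bot fun S hS =>
      ih _ (by rwa [FI.card_iter] at hS) S rfl
    have top : V.lower (FI.iter n) = ⊤ := (isZero_HAt_zero_iff n V).1 (h n)
    have := (Submodule.subsingleton_iff R).1 (subsingleton_of_bot_eq_top (bot.symm.trans top))
    exact subsingleton_obj_of_card_eq V ((FI.card_iter n).trans hn.symm)

section Shift

variable (V : FIModule.{u} R)

/-- The kernel of `V ⟶ SV`. -/
noncomputable abbrev shiftKernel : FIModule.{u} R := kernel (toShift.app V)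

/-- The cokernel of `V ⟶ SV`, often called the derivative of `V`. -/
noncomputable abbrev derivative : FIModule.{u} R := cokernel (toShift.app V)

lemma lower_shiftKernel (T : FI) : V.shiftKernel.lower T = ⊥ := by
  refine Submodule.span_eq_bot.2 ?_
  rintro _ ⟨S, f, y, hS, rfl⟩
  obtain ⟨g, rfl⟩ := FI.exists_eq_incl_comp f hS
  let ι : V.shiftKernel ⟶ V := kernel.ι (toShift.app V)
  have hy : (V.map S.incl).hom ((ι.app S).hom y) = 0 :=
    ConcreteCategory.congr_hom (NatTrans.congr_app (kernel.condition (toShift.app V)) S) y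
  apply app_injective_of_mono ι T
  calc (ι.app T).hom ((V.shiftKernel.map (S.incl ≫ g)).hom y)
    _ = (V.map (S.incl ≫ g)).hom ((ι.app S).hom y) := NatTrans.naturality_apply ι _ y
    _ = (ι.app T).hom 0 := by rw [map_comp_hom_apply, hy, map_zero, map_zero]

variable {V} {n p : ℕ}

lemma isZero_HAt_zero_derivative (h : IsZero ((HAt R (n + 1) 0).obj V)) :
    IsZero ((HAt R n 0).obj V.derivative) := by
  rw [isZero_HAt_zero_iff] at h ⊢
  let π : (shift R).obj V ⟶ V.derivative := cokernel.π (toShift.app V)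
  have range_le : LinearMap.range (V.map (FI.iter n).incl).hom ≤
      LinearMap.ker (π.app (FI.iter n)).hom := by
    rintro _ ⟨x, rfl⟩
    exact ConcreteCategory.congr_hom
      (NatTrans.congr_app (cokernel.condition (toShift.app V)) (FI.iter n)) x
  calc V.derivative.lower (FI.iter n)
    _ = (((shift R).obj V).lower (FI.iter n)).map (π.app (FI.iter n)).hom :=
      (map_lower_of_epi π _).symm
    _ = (((shift R).obj V).lower (FI.iter n) ⊔
        LinearMap.range (V.map (FI.iter n).incl).hom).map (π.app (FI.iter n)).hom := by
      rw [Submodule.map_sup, LinearMap.le_ker_iff_map.1 range_le, sup_bot_eq]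
    _ = Submodule.map (π.app (FI.iter n)).hom ⊤ :=
      congrArg _ ((V.lower_shift_obj (FI.iter n)).symm.trans h)
    _ = ⊤ := (Submodule.map_top _).trans
      (LinearMap.range_eq_top.2 (app_surjective_of_epi π (FI.iter n)))

lemma isZero_HAt_one_derivative (h : IsZero ((HAt R (n + 1) 1).obj V)) :
    IsZero ((HAt R n 1).obj V.derivative) :=
  have ⟨_, _⟩ := (isZero_HAt_succ_iff n 0 V).1 h
  isZero_leftDerived_one_cokernel (H0At R (FI.iter n))

lemma isZero_HAt_shiftKernel
    (h1 : ∀ m, m + p = n → IsZero ((HAt R (m + 1) 1).obj V))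
    (h2 : ∀ m, m + p = n → IsZero ((HAt R m 2).obj V.derivative)) :
    IsZero ((HAt R n p).obj V.shiftKernel) := by
  refine isZero_HAt_of_subsingleton_obj fun T hT => ?_
  have ⟨_, _⟩ := (isZero_HAt_succ_iff (Nat.card T) 0 V).1 (h1 _ hT)
  have top := (isZero_HAt_zero_iff (Nat.card T) _).1
    (isZero_leftDerived_zero_kernel (H0At R (FI.iter (Nat.card T))) (h2 _ hT))
  have := (Submodule.subsingleton_iff R).1
    (subsingleton_of_bot_eq_top ((lower_shiftKernel V _).symm.trans top))
  exact subsingleton_obj_of_card_eq V.shiftKernel (FI.card_iter (Nat.card T))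

lemma isZero_HAt_succ_succ (h1 : ∀ m, m + p = n → IsZero ((HAt R (m + 1) 1).obj V))
    (h2 : ∀ m, m + p = n → IsZero ((HAt R m 2).obj V.derivative))
    (hD : IsZero ((HAt R n (p + 1)).obj V.derivative)) :
    IsZero ((HAt R (n + 1) (p + 1)).obj V) :=
  (isZero_HAt_succ_iff n p V).2
    (epi_mono_leftDerived_map_of_isZero _ p (isZero_HAt_shiftKernel h1 h2) hD)

end Shift

lemma isZero_HAt_succ_of_forall_one {V : FIModule.{u} R} (h1 : ∀ n, IsZero ((HAt R n 1).obj V))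
    (n p : ℕ) : IsZero ((HAt R n (p + 1)).obj V) := by
  induction n using Nat.strong_induction_on generalizing p V with
  | _ n ih =>
    cases n with
    | zero => exact isZero_HAt_zero_succ p V
    | succ n =>
      have ihD (m : ℕ) (hm : m ≤ n) (q : ℕ) : IsZero ((HAt R m (q + 1)).obj V.derivative) :=
        ih m (by omega) (fun l => isZero_HAt_one_derivative (h1 (l + 1))) q
      exact isZero_HAt_succ_succ (fun m _ => h1 (m + 1)) (fun m hm => ihD m (by omega) 1)
        (ihD n le_rfl p)

lemma isZero_HAt_succ_of_add_le {V : FIModule.{u} R} {k d : ℕ}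
    (h0 : ∀ n, k ≤ n → IsZero ((HAt R n 0).obj V))
    (h1 : ∀ n, d < n → IsZero ((HAt R n 1).obj V)) {n p : ℕ} (hn : p + k + d ≤ n) :
    IsZero ((HAt R n (p + 1)).obj V) := by
  induction k generalizing V d n p with
  | zero =>
    exact isZero_HAt_of_subsingleton_obj fun T _ =>
      subsingleton_obj_of_forall_isZero (fun n => h0 n n.zero_le) T
  | succ k ih =>
    cases d with
    | zero =>
      refine isZero_HAt_succ_of_forall_one (fun m => ?_) n p
      cases m with
      | zero => exact isZero_HAt_zero_succ 0 V
      | succ m => exact h1 _ m.succ_pos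
    | succ d =>
      obtain ⟨n, rfl⟩ := Nat.exists_eq_add_of_le' (Nat.one_le_of_lt hn)
      have ihD {m q : ℕ} (hm : q + k + d ≤ m) : IsZero ((HAt R m (q + 1)).obj V.derivative) :=
        ih (fun l hl => isZero_HAt_zero_derivative (h0 (l + 1) (by omega)))
          (fun l hl => isZero_HAt_one_derivative (h1 (l + 1) (by omega))) hm
      exact isZero_HAt_succ_succ (fun m hm => h1 (m + 1) (by omega))
        (fun m hm => ihD (by omega)) (ihD (by omega))

section Degree

variable {W : FIModule.{u} R} {n p : ℕ}

lemma subsingleton_obj_iter_of_deg_lt (h : W.deg < n) : Subsingleton (W.obj (FI.iter n)) := by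
  obtain ⟨k, hk, hkn⟩ := sInf_lt_iff.1 h
  have := hk n hkn
  exact subsingleton_obj_of_card_eq W (S := FI.std n) ((Nat.card_fin n).trans (FI.card_iter n).symm)

lemma isZero_HAt_zero_of_deg_lt (h : ((H0 R).obj W).deg < n) : IsZero ((HAt R n 0).obj W) :=
  (isZero_HAt_zero_iff n W).2
    (Submodule.Quotient.subsingleton_iff.1 (subsingleton_obj_iter_of_deg_lt h))

lemma isZero_HAt_of_deg_lt (h : ((H R p).obj W).deg < n) : IsZero ((HAt R n p).obj W) :=
  (isZero_HAt_iff n p W).2 (subsingleton_obj_iter_of_deg_lt h)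

lemma deg_le_of_forall {c : WithBot ℕ∞}
    (h : ∀ n : ℕ, c < n → Subsingleton (W.obj (FI.iter n))) : W.deg ≤ c :=
  sInf_le fun n hn =>
    have := h n hn
    subsingleton_obj_of_card_eq W ((FI.card_iter n).trans (Nat.card_fin n).symm)

lemma deg_add_one_le_of_forall {c : WithBot ℕ∞}
    (h : ∀ n : ℕ, c ≤ n → Subsingleton (W.obj (FI.iter n))) : W.deg + 1 ≤ c := by
  have deg_of_forall (h : ∀ n, Subsingleton (W.obj (FI.iter n))) : W.deg = ⊥ :=
    le_bot_iff.1 (deg_le_of_forall fun n _ => h n)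
  match c with
  | ⊥ => simp [deg_of_forall fun n => h n bot_le]
  | (⊤ : ℕ∞) => exact le_top
  | ((0 : ℕ) : ℕ∞) => simp [deg_of_forall fun n => h n (by exact_mod_cast n.zero_le)]
  | ((m + 1 : ℕ) : ℕ∞) =>
    have : W.deg ≤ m := deg_le_of_forall fun n hn => h n (by exact_mod_cast hn)
    exact_mod_cast add_le_add_left this 1

end Degree

theorem theoremA_general (W : FIModule.{u} R) {k d : WithBot ℕ∞}
    (h0 : ((H0 R).obj W).deg ≤ k) (h1 : ((H R 1).obj W).deg ≤ d) {p : ℕ} (hp : 0 < p) :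
    ((H R p).obj W).deg + 1 ≤ (p : WithBot ℕ∞) + k + d := by
  obtain ⟨p, rfl⟩ := Nat.exists_eq_add_of_le' hp
  have hk (n : ℕ) (hn : k < n) := isZero_HAt_zero_of_deg_lt (h0.trans_lt hn)
  have hd (n : ℕ) (hn : d < n) := isZero_HAt_of_deg_lt (h1.trans_lt hn)
  refine deg_add_one_le_of_forall fun n hn => (isZero_HAt_iff n (p + 1) W).1 ?_
  match k, d with
  | ⊥, _ =>
    exact isZero_HAt_of_subsingleton_obj fun T _ =>
      subsingleton_obj_of_forall_isZero (fun m => hk m (WithBot.bot_lt_coe _)) T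
  | _, ⊥ => exact isZero_HAt_succ_of_forall_one (fun m => hd m (WithBot.bot_lt_coe _)) n p
  | (k : ℕ∞), (d : ℕ∞) =>
    have hn : (p + 1 + k + d : ℕ∞) ≤ n := by exact_mod_cast hn
    match k, d with
    | ⊤, _ | _, ⊤ => simp at hn
    | (k : ℕ), (d : ℕ) =>
      exact isZero_HAt_succ_of_add_le (k := k + 1) (d := d)
        (fun m hm => hk m (by exact_mod_cast hm)) (fun m hm => hd m (by exact_mod_cast hm))
        (by have : p + 1 + k + d ≤ n := by exact_mod_cast hn
            omega)

end FIModule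

theorem theoremA (W : FIModule.{u} ℤ) (k d : WithBot ℕ∞) (hk : k ≠ ⊤) (hd : d ≠ ⊤)
    (h0 : ((FIModule.H0 ℤ).obj W).deg ≤ k) (h1 : ((FIModule.H ℤ 1).obj W).deg ≤ d)
    (p : ℕ) (hp : 0 < p) :
    ((FIModule.H ℤ p).obj W).deg + 1 ≤ (p : WithBot ℕ∞) + k + d :=
  FIModule.theoremA_general W h0 h1 hp
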